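/- **Theorem (Weak reverse Minkowski).** Let $n\ge 0$ and let $\Lambda\subset\mathbb R^n$ be a full-rank lattice. A linear subspace $W\subseteq\mathbb R^n$ is a *lattice subspace* of $\Lambda$ if it has a basis consisting of vectors of $\Lambda$; for such a $W$, $\det(\Lambda\cap W)$ denotes the determinant (covolume) of the lattice $\Lambda\cap W$ in the Euclidean space $W$. A *symmetric convex body* is a compact convex set $K\subset\mathbb R^n$ with non-empty interior and $K=-K$. For such a $K$ (and, more generally, for a dilate $tK$ with $t\ge 0$) and for a radius $r\ge 0$, put $$M(K,\Lambda)=\max_{W}\frac{\operatorname{vol}_d(K\cap W)}{\det(\Lambda\cap W)},\qquad M(r,\Lambda)=\max_{W}\frac{\operatorname{vol}_d(rB_2^d)}{\det(\Lambda\cap W)},$$ where $W$ ranges over all lattice subspaces of $\Lambda$, of every dimension $d=\dim W\in\{0,\dots,n\}$, $B_2^d$ is the closed Euclidean unit ball of $\mathbb R^d$, and the quotient for $d=0$ is $1$. Then, for every symmetric convex body $K\subset\mathbb R^n$, the maximum $M(3nK,\Lambda)$ exists, $K\cap\Lambda$ is finite, and $$|K\cap\Lambda|\le M(3nK,\Lambda).$$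 Furthermore, for every $r>0$, the maximum $M(6\sqrt n\,r,\Lambda)$ exists, $rB_2^n\cap\Lambda$ is finite, and $$|rB_2^n\cap\Lambda|\le M(6\sqrt n\,r,\Lambda).$$ -/

import Mathlib

open MeasureTheory Module

open scoped Pointwise

/-- A symmetric convex body: a convex compact set `K` with non-empty interior and `K = -K`. -/
structure IsSymmConvexBody {n : ℕ} (K : Set (EuclideanSpace ℝ (Fin n))) : Prop where
  convex : Convex ℝ K
  isCompact : IsCompact K
  interior_nonempty : (interior K).Nonempty
  symm : K = -K

/-- `W` is a lattice subspace of `L`: it admits a basis of vectors in `L`. -/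
def IsLatticeSubspace {n : ℕ} (L : Submodule ℤ (EuclideanSpace ℝ (Fin n)))
    (W : Submodule ℝ (EuclideanSpace ℝ (Fin n))) : Prop :=
  ∃ b : Basis (Fin (finrank ℝ W)) ℝ W, ∀ i, (b i : EuclideanSpace ℝ (Fin n)) ∈ L

/-- The lattice `L ∩ W`, as a subgroup of the Euclidean space `W`. -/
def interSubspace {n : ℕ} (L : Submodule ℤ (EuclideanSpace ℝ (Fin n)))
    (W : Submodule ℝ (EuclideanSpace ℝ (Fin n))) : Submodule ℤ W :=
  L.comap (W.subtype.restrictScalars ℤ)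

/-- `det (L ∩ W)`: the covolume of `L ∩ W` for the Lebesgue measure of the Euclidean space `W`. -/
noncomputable def latticeDet {n : ℕ} (L : Submodule ℤ (EuclideanSpace ℝ (Fin n)))
    (W : Submodule ℝ (EuclideanSpace ℝ (Fin n))) : ℝ :=
  ZLattice.covolume (interSubspace L W) (volume : Measure W)

/-- The quotients `vol_d (K ∩ W) / det (L ∩ W)`, with `W` a lattice subspace of `L` of any
dimension `d`, `0 ≤ d ≤ n`. -/
noncomputable def bodyQuotients {n : ℕ} (K : Set (EuclideanSpace ℝ (Fin n)))
    (L : Submodule ℤ (EuclideanSpace ℝ (Fin n))) : Set ℝ :=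
  {q | ∃ W : Submodule ℝ (EuclideanSpace ℝ (Fin n)), IsLatticeSubspace L W ∧
    q = (volume : Measure W).real {w : W | (w : EuclideanSpace ℝ (Fin n)) ∈ K} / latticeDet L W}

/-- `M (K, L)`. -/
noncomputable def bodyM {n : ℕ} (K : Set (EuclideanSpace ℝ (Fin n)))
    (L : Submodule ℤ (EuclideanSpace ℝ (Fin n))) : ℝ :=
  sSup (bodyQuotients K L)

/-- The quotients `vol_d (r B_2^d) / det (L ∩ W)`, with `W` a lattice subspace of `L` of any
dimension `d`, `0 ≤ d ≤ n`. -/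
noncomputable def ballQuotients {n : ℕ} (r : ℝ)
    (L : Submodule ℤ (EuclideanSpace ℝ (Fin n))) : Set ℝ :=
  {q | ∃ W : Submodule ℝ (EuclideanSpace ℝ (Fin n)), IsLatticeSubspace L W ∧
    q = (volume : Measure (EuclideanSpace ℝ (Fin (finrank ℝ W)))).real (Metric.closedBall 0 r) /
      latticeDet L W}

/-- `M (r, L)`. -/
noncomputable def ballM {n : ℕ} (r : ℝ)
    (L : Submodule ℤ (EuclideanSpace ℝ (Fin n))) : ℝ :=
  sSup (ballQuotients r L)

/-! Let `W` be the span of `K ∩ L`, which is a lattice subspace. Writing a point of `W` in a basis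
taken from `K ∩ L` and rounding the coefficients moves it, modulo `L ∩ W`, into `d • K`
(`Convex.sum_mem_card_smul`), or into a ball of radius `√d * r` when `K` is a ball
(`exists_int_norm_sq_sum_le`). Adding all of `K ∩ L` keeps it inside the enlarged body, so every
coset of `L ∩ W` meets that body at least `#(K ∩ L)` times; integrating over a fundamental domain
bounds this number by volume over determinant.

The maximum exists because quotients at least `1` force a bounded determinant, and only finitely
many lattice subspaces have one: by Blichfeldt such a `W` has of order `R ^ d` lattice points in a
ball of radius `R`, while a proper subspace can hold only `O(R ^ (d - 1))`. Hence short vectors span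
`W`. -/

/-! ### Unfolding, packing and rounding -/

section General

variable {E : Type*} [NormedAddCommGroup E] [NormedSpace ℝ E] [FiniteDimensional ℝ E]
  [MeasurableSpace E] [BorelSpace E]

/-- Unfolding of a measurable set along the translates of a fundamental domain of a lattice. -/
theorem exists_measure_eq_lintegral_encard (L : Submodule ℤ E) [DiscreteTopology L]
    [IsZLattice ℝ L] (μ : Measure E) [μ.IsAddHaarMeasure] {t : Set E} (ht : MeasurableSet t) :
    ∃ F : Set E, μ F = ENNReal.ofReal (ZLattice.covolume L μ) ∧
      μ t = ∫⁻ x in F, (({g : L | (g : E) + x ∈ t}.encard : ℕ∞) : ENNReal) ∂μ := by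
  let b := Module.Free.chooseBasis ℤ L
  have : VAddInvariantMeasure L E μ := ⟨fun c s _ => measure_preimage_add μ (c : E) s⟩
  have hF := ZLattice.isAddFundamentalDomain b μ
  refine ⟨ZSpan.fundamentalDomain (b.ofZLatticeBasis ℝ), ?_, ?_⟩
  · rw [ZLattice.covolume_eq_measure_fundamentalDomain L μ hF, Measure.real,
      ENNReal.ofReal_toReal]
    exact (ZSpan.fundamentalDomain_isBounded _).measure_lt_top.ne
  · have h := hF.lintegral_eq_tsum'' (t.indicator 1)
    rw [lintegral_indicator_one ht] at h
    rw [h, ← lintegral_tsum]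
    · refine lintegral_congr fun x => ?_
      rw [← ENNReal.tsum_set_one, tsum_subtype {g : L | (g : E) + x ∈ t} (fun _ => (1 : ENNReal))]
      refine tsum_congr fun g => ?_
      by_cases hg : (g : E) + x ∈ t <;> simp [Submodule.vadd_def, hg]
    · intro g
      exact ((measurable_one.indicator ht).comp (measurable_const_vadd g)).aemeasurable

/-- The count of coset points in `t`, integrated over a fundamental domain, is `μ t`; a pointwise
bound on the count therefore integrates to a bound on the measure. -/
theorem natCast_mul_covolume_le (L : Submodule ℤ E) [DiscreteTopology L]
    [IsZLattice ℝ L] (μ : Measure E) [μ.IsAddHaarMeasure] {t : Set E} (ht : MeasurableSet t)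
    (htop : μ t ≠ ⊤) (N : ℕ) (h : ∀ x, (N : ℕ∞) ≤ {g : L | (g : E) + x ∈ t}.encard) :
    N * ZLattice.covolume L μ ≤ μ.real t := by
  obtain ⟨F, hF, hint⟩ := exists_measure_eq_lintegral_encard L μ ht
  have h1 : ∫⁻ _ in F, (N : ENNReal) ∂μ ≤ μ t := by
    rw [hint]
    exact lintegral_mono fun x => by simpa using ENat.toENNReal_mono (h x)
  rw [setLIntegral_const, hF] at h1
  have := ENNReal.toReal_mono htop h1
  rwa [ENNReal.toReal_mul, ENNReal.toReal_natCast,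
    ENNReal.toReal_ofReal (ZLattice.covolume_pos L μ).le] at this

theorem measureReal_le_natCast_mul_covolume (L : Submodule ℤ E) [DiscreteTopology L]
    [IsZLattice ℝ L] (μ : Measure E) [μ.IsAddHaarMeasure] {t : Set E} (ht : MeasurableSet t)
    (N : ℕ) (h : ∀ x, {g : L | (g : E) + x ∈ t}.encard ≤ (N : ℕ∞)) :
    μ.real t ≤ N * ZLattice.covolume L μ := by
  obtain ⟨F, hF, hint⟩ := exists_measure_eq_lintegral_encard L μ ht
  have h1 : μ t ≤ ∫⁻ _ in F, (N : ENNReal) ∂μ := by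
    rw [hint]
    exact lintegral_mono fun x => by simpa using ENat.toENNReal_mono (h x)
  rw [setLIntegral_const, hF] at h1
  have := ENNReal.toReal_mono (ENNReal.mul_ne_top (by simp) (by simp)) h1
  rwa [ENNReal.toReal_mul, ENNReal.toReal_natCast,
    ENNReal.toReal_ofReal (ZLattice.covolume_pos L μ).le] at this

/-- The packing bound for a separated set in a ball. -/
theorem card_mul_pow_le_of_separated {F : Type*} [NormedAddCommGroup F] [NormedSpace ℝ F]
    [FiniteDimensional ℝ F] (S : Finset F) {δ R : ℝ} (hδ : 0 < δ) (hR : 0 ≤ R)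
    (hS : ∀ x ∈ S, ‖x‖ ≤ R) (hsep : ∀ x ∈ S, ∀ y ∈ S, x ≠ y → 2 * δ ≤ dist x y) :
    S.card * δ ^ finrank ℝ F ≤ (R + δ) ^ finrank ℝ F := by
  let _ : MeasurableSpace F := borel F
  have : BorelSpace F := ⟨rfl⟩
  let μ : Measure F := Measure.addHaar
  have hdisj : (S : Set F).PairwiseDisjoint fun x => Metric.ball x δ := by
    intro x hx y hy hxy
    exact Metric.ball_disjoint_ball (by linarith [hsep x hx y hy hxy])
  have hsub : (⋃ x ∈ S, Metric.ball x δ) ⊆ Metric.closedBall 0 (R + δ) := by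
    intro y hy
    simp only [Set.mem_iUnion, Metric.mem_ball] at hy
    obtain ⟨x, hx, hy⟩ := hy
    rw [mem_closedBall_zero_iff]
    have := norm_le_norm_add_norm_sub' y x
    rw [dist_eq_norm] at hy
    linarith [hS x hx]
  have h := measure_mono (μ := μ) hsub
  rw [measure_biUnion_finset hdisj fun _ _ => measurableSet_ball,
    Measure.addHaar_closedBall _ _ (by positivity)] at h
  simp_rw [Measure.addHaar_ball_of_pos _ _ hδ] at h
  -- The volume of the unit ball cancels, so the choice of Haar measure is immaterial.
  rw [Finset.sum_const, nsmul_eq_mul, ← mul_assoc,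
    ENNReal.mul_le_mul_iff_left (Metric.measure_ball_pos μ 0 one_pos).ne'
      measure_ball_lt_top.ne] at h
  have := ENNReal.toReal_mono (by simp) h
  rwa [ENNReal.toReal_mul, ENNReal.toReal_natCast, ENNReal.toReal_ofReal (by positivity),
    ENNReal.toReal_ofReal (by positivity)] at this

/-- A sum of vectors of a convex set lies in the corresponding dilate. -/
theorem Convex.sum_mem_card_smul {F ι : Type*} [AddCommGroup F] [Module ℝ F] {K : Set F}
    (hK : Convex ℝ K) (h0 : (0 : F) ∈ K) (s : Finset ι) (z : ι → F) (hz : ∀ i ∈ s, z i ∈ K) :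
    ∑ i ∈ s, z i ∈ (s.card : ℝ) • K := by
  classical
  induction s using Finset.induction_on with
  | empty => simpa using ⟨0, h0, by simp⟩
  | insert a s ha ih =>
    rw [Finset.sum_insert ha, Finset.card_insert_of_notMem ha, Nat.cast_succ, add_comm (s.card : ℝ),
      hK.add_smul zero_le_one (Nat.cast_nonneg _), one_smul]
    exact Set.add_mem_add (hz a (Finset.mem_insert_self a s))
      (ih fun i hi => hz i (Finset.mem_insert_of_mem hi))

/-- Greedy rounding of the coefficients of a linear combination of short vectors. -/
theorem exists_int_norm_sq_sum_le {F ι : Type*} [NormedAddCommGroup F] [InnerProductSpace ℝ F]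
    {r : ℝ} (s : Finset ι) (v : ι → F) (hv : ∀ i ∈ s, ‖v i‖ ≤ r) (a : ι → ℝ) :
    ∃ k : ι → ℤ, ‖∑ i ∈ s, (a i - k i) • v i‖ ^ 2 ≤ s.card * r ^ 2 := by
  classical
  induction s using Finset.induction_on with
  | empty => exact ⟨0, by simp⟩
  | insert j s hj ih =>
    obtain ⟨k, hk⟩ := ih fun i hi => hv i (Finset.mem_insert_of_mem hi)
    set w := ∑ i ∈ s, (a i - k i) • v i with hw
    -- Rounding down or up according to the sign of the inner product makes the cross term
    -- nonpositive, so the squared norm grows by at most `r ^ 2`.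
    obtain ⟨m, hm1, hm2⟩ : ∃ m : ℤ, (a j - m) ^ 2 ≤ 1 ∧ (a j - m) * inner ℝ (v j) w ≤ 0 := by
      have h1 := Int.floor_le (a j)
      have h2 := Int.lt_floor_add_one (a j)
      rcases le_total (inner ℝ (v j) w) 0 with h | h
      · exact ⟨⌊a j⌋, by nlinarith, by nlinarith⟩
      · refine ⟨⌊a j⌋ + 1, ?_, ?_⟩ <;> push_cast <;> nlinarith
    refine ⟨Function.update k j m, ?_⟩
    have hs : ∑ i ∈ s, (a i - (Function.update k j m i : ℤ)) • v i = w :=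
      Finset.sum_congr rfl fun i hi => by
        rw [Function.update_of_ne (ne_of_mem_of_not_mem hi hj)]
    rw [Finset.sum_insert hj, hs, Function.update_self, Finset.card_insert_of_notMem hj,
      norm_add_sq_real, norm_smul, mul_pow, Real.norm_eq_abs, sq_abs, inner_smul_left]
    have hvj : ‖v j‖ ^ 2 ≤ r ^ 2 :=
      pow_le_pow_left₀ (norm_nonneg _) (hv j (Finset.mem_insert_self j s)) 2
    have := mul_le_mul hm1 hvj (by positivity) zero_le_one
    simp only [conj_trivial]
    push_cast
    linarith

end General

/-! ### Lattice subspaces and their determinants -/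

section Subspace

variable {n : ℕ} {L : Submodule ℤ (EuclideanSpace ℝ (Fin n))}
  {W : Submodule ℝ (EuclideanSpace ℝ (Fin n))}

instance discreteTopology_interSubspace [DiscreteTopology L] :
    DiscreteTopology (interSubspace L W) :=
  ZLattice.comap_discreteTopology ℝ L (e := W.subtype) continuous_subtype_val
    Subtype.val_injective

theorem IsLatticeSubspace.isZLattice [DiscreteTopology L] (hW : IsLatticeSubspace L W) :
    IsZLattice ℝ (interSubspace L W) := by
  obtain ⟨b, hb⟩ := hW
  refine ⟨top_le_iff.mp ?_⟩
  rw [← b.span_eq]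
  refine Submodule.span_mono ?_
  rintro _ ⟨i, rfl⟩
  exact hb i

theorem IsLatticeSubspace.latticeDet_pos [DiscreteTopology L] (hW : IsLatticeSubspace L W) :
    0 < latticeDet L W := by
  have := hW.isZLattice
  exact ZLattice.covolume_pos _ _

theorem isLatticeSubspace_span {s : Set (EuclideanSpace ℝ (Fin n))} (hs : s ⊆ L) :
    IsLatticeSubspace L (Submodule.span ℝ s) := by
  obtain ⟨f, hf, hspan, hli⟩ := Submodule.exists_fun_fin_finrank_span_eq ℝ s
  refine ⟨(Basis.span hli).map (LinearEquiv.ofEq _ _ hspan), fun i => ?_⟩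
  have : (((Basis.span hli).map (LinearEquiv.ofEq _ _ hspan) i :
      Submodule.span ℝ s) : EuclideanSpace ℝ (Fin n)) = f i := by
    simp [Basis.span_apply]
  rw [this]
  exact hs (hf i)

theorem isLatticeSubspace_bot : IsLatticeSubspace L ⊥ := by
  rw [← Submodule.span_empty]
  exact isLatticeSubspace_span (Set.empty_subset _)

theorem isBounded_preimage_subtype {t : Set (EuclideanSpace ℝ (Fin n))}
    (ht : Bornology.IsBounded t) :
    Bornology.IsBounded {w : W | (w : EuclideanSpace ℝ (Fin n)) ∈ t} := by
  obtain ⟨R, hR⟩ := ht.subset_closedBall 0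
  refine Metric.isBounded_closedBall (x := (0 : W)) (r := R) |>.subset fun w hw => ?_
  simpa using hR hw

/-- If the translates of the points of `s ⊆ L ∩ W` by a representative of each class of `W` modulo
`L ∩ W` lie in `t`, then `#s ≤ vol (t ∩ W) / det (L ∩ W)`. -/
theorem IsLatticeSubspace.ncard_le [DiscreteTopology L] (hW : IsLatticeSubspace L W)
    {s t : Set (EuclideanSpace ℝ (Fin n))} (hs : s.Finite) (hsL : s ⊆ L) (hsW : s ⊆ W)
    (ht : IsClosed t) (htb : Bornology.IsBounded t)
    (hcov : ∀ x ∈ W, ∃ l ∈ L, l ∈ W ∧ ∀ y ∈ s, x - l + y ∈ t) :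
    (s.ncard : ℝ) ≤
      (volume : Measure W).real {w : W | (w : EuclideanSpace ℝ (Fin n)) ∈ t} / latticeDet L W := by
  have := hW.isZLattice
  rw [le_div_iff₀ hW.latticeDet_pos]
  refine natCast_mul_covolume_le (interSubspace L W) volume
    (ht.preimage continuous_subtype_val).measurableSet
    (isBounded_preimage_subtype htb).measure_lt_top.ne _ fun x => ?_
  obtain ⟨l, hlL, hlW, hl⟩ := hcov x x.2
  rw [hs.cast_ncard_eq]
  refine le_trans (Set.encard_le_encard ?_)
    (Set.encard_image_le (fun g : interSubspace L W => ((g : W) : EuclideanSpace ℝ (Fin n)) + l) _)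
  -- The lattice points `y - l`, for `y ∈ s`, all translate `x` into `t`.
  intro y hy
  refine ⟨⟨⟨y - l, W.sub_mem (hsW hy) hlW⟩, L.sub_mem (hsL hy) hlL⟩, ?_, by simp⟩
  have := hl y hy
  rwa [show (x : EuclideanSpace ℝ (Fin n)) - l + y = y - l + x by abel] at this

theorem finite_inter_lattice [DiscreteTopology L] {s : Set (EuclideanSpace ℝ (Fin n))}
    (hs : Bornology.IsBounded s) : (s ∩ (L : Set (EuclideanSpace ℝ (Fin n)))).Finite := by
  have : DiscreteTopology L.toAddSubgroup := ‹DiscreteTopology L›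
  exact Metric.finite_isBounded_inter_isClosed DiscreteTopology.isDiscrete hs
    (AddSubgroup.isClosed_of_discrete (H := L.toAddSubgroup))

theorem exists_separation (L : Submodule ℤ (EuclideanSpace ℝ (Fin n))) [DiscreteTopology L] :
    ∃ δ > 0, ∀ x ∈ L, ∀ y ∈ L, x ≠ y → 2 * δ ≤ dist x y := by
  obtain ⟨ε, hε, h⟩ := Metric.exists_ball_inter_eq_singleton_of_mem_discrete
    (s := (L : Set (EuclideanSpace ℝ (Fin n)))) DiscreteTopology.isDiscrete L.zero_mem
  refine ⟨ε / 2, by positivity, fun x hx y hy hxy => ?_⟩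
  by_contra hlt
  have : x - y ∈ Metric.ball 0 ε ∩ (L : Set (EuclideanSpace ℝ (Fin n))) := by
    refine ⟨?_, L.sub_mem hx hy⟩
    rw [mem_ball_zero_iff, ← dist_eq_norm]
    linarith
  rw [h, Set.mem_singleton_iff, sub_eq_zero] at this
  exact hxy this

theorem volume_real_subspace_closedBall (W : Submodule ℝ (EuclideanSpace ℝ (Fin n))) (r : ℝ) :
    (volume : Measure W).real {w : W | (w : EuclideanSpace ℝ (Fin n)) ∈ Metric.closedBall 0 r} =
      (volume : Measure (EuclideanSpace ℝ (Fin (finrank ℝ W)))).real (Metric.closedBall 0 r) := by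
  have h := (stdOrthonormalBasis ℝ W).measurePreserving_repr.measureReal_preimage
    (s := Metric.closedBall 0 r) measurableSet_closedBall.nullMeasurableSet
  rw [← h]
  congr 1
  ext w
  simp

theorem ballQuotients_eq (r : ℝ) (L : Submodule ℤ (EuclideanSpace ℝ (Fin n))) :
    ballQuotients r L = bodyQuotients (Metric.closedBall 0 r) L := by
  simp only [ballQuotients, bodyQuotients, volume_real_subspace_closedBall]

end Subspace

/-! ### Existence of the maximum -/

section Maximum

variable {n : ℕ} {L : Submodule ℤ (EuclideanSpace ℝ (Fin n))}

/-- A Blichfeldt type lower bound for the number of lattice points in a ball. -/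
theorem IsLatticeSubspace.volume_le_ncard_mul [DiscreteTopology L]
    {W : Submodule ℝ (EuclideanSpace ℝ (Fin n))} (hW : IsLatticeSubspace L W) (R : ℝ) :
    (volume : Measure (EuclideanSpace ℝ (Fin (finrank ℝ W)))).real (Metric.closedBall 0 (R / 2)) ≤
      (((W : Set (EuclideanSpace ℝ (Fin n))) ∩ Metric.closedBall 0 R) ∩
        (L : Set (EuclideanSpace ℝ (Fin n)))).ncard * latticeDet L W := by
  have := hW.isZLattice
  rw [← volume_real_subspace_closedBall]
  have hfin := finite_inter_lattice (L := L)
    (Metric.isBounded_closedBall.subset (Set.inter_subset_right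
      (s := (W : Set (EuclideanSpace ℝ (Fin n)))) (t := Metric.closedBall 0 R)))
  refine measureReal_le_natCast_mul_covolume (interSubspace L W) volume
    (Metric.isClosed_closedBall.preimage continuous_subtype_val).measurableSet _ fun x => ?_
  rw [hfin.cast_ncard_eq]
  rcases Set.eq_empty_or_nonempty {g : interSubspace L W | (g : W) + x ∈
    {w : W | (w : EuclideanSpace ℝ (Fin n)) ∈ Metric.closedBall 0 (R / 2)}} with h | ⟨g₀, hg₀⟩
  · exact (congrArg Set.encard h).le.trans (by simp)
  -- Differences with a fixed `g₀` are lattice points of norm at most `R / 2 + R / 2`.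
  refine Set.encard_le_encard_of_injOn
    (f := fun g => ((g : W) : EuclideanSpace ℝ (Fin n)) - (g₀ : W)) ?_ ?_
  · intro g hg
    refine ⟨⟨W.sub_mem (g : W).2 (g₀ : W).2, ?_⟩, L.sub_mem g.2 g₀.2⟩
    simp only [Set.mem_ofPred_eq, mem_closedBall_zero_iff, Submodule.coe_add,
      Set.mem_preimage] at hg hg₀ ⊢
    have := norm_sub_le (((g : W) : EuclideanSpace ℝ (Fin n)) + x) ((g₀ : W) + x)
    rw [add_sub_add_right_eq_sub] at this
    linarith
  · intro g _ g' _ h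
    exact Subtype.ext (Subtype.ext (sub_left_injective h))

/-- Packing inside the span of `s` makes the exponent the dimension of that span rather than `n`. -/
theorem ncard_mul_pow_le {δ R : ℝ} (hδ : 0 < δ) (hR : 0 ≤ R)
    (hsep : ∀ x ∈ L, ∀ y ∈ L, x ≠ y → 2 * δ ≤ dist x y)
    {s : Set (EuclideanSpace ℝ (Fin n))} (hsL : s ⊆ L) (hsR : ∀ x ∈ s, ‖x‖ ≤ R) (hs : s.Finite) :
    s.ncard * δ ^ finrank ℝ (Submodule.span ℝ s) ≤ (R + δ) ^ finrank ℝ (Submodule.span ℝ s) := by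
  have hfin : (Subtype.val ⁻¹' s : Set (Submodule.span ℝ s)).Finite :=
    hs.preimage Subtype.val_injective.injOn
  have := card_mul_pow_le_of_separated hfin.toFinset hδ hR
    (fun x hx => hsR _ (by simpa using hx)) (fun x hx y hy hxy =>
      hsep x (hsL (by simpa using hx)) y (hsL (by simpa using hy)) (by simpa using hxy))
  rwa [← Set.ncard_eq_toFinset_card _ hfin, Set.ncard_preimage_of_injective_subset_range
    Subtype.val_injective (by simp)] at this

/-- Lattice subspaces of bounded determinant are spanned by lattice vectors of bounded length. -/
theorem exists_radius_span_eq (L : Submodule ℤ (EuclideanSpace ℝ (Fin n))) [DiscreteTopology L]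
    (C : ℝ) (d : ℕ) : ∃ R : ℝ, ∀ W : Submodule ℝ (EuclideanSpace ℝ (Fin n)),
      IsLatticeSubspace L W → latticeDet L W ≤ C → finrank ℝ W = d →
      Submodule.span ℝ (((W : Set (EuclideanSpace ℝ (Fin n))) ∩ Metric.closedBall 0 R) ∩
        (L : Set (EuclideanSpace ℝ (Fin n)))) = W := by
  obtain ⟨δ, hδ, hsep⟩ := exists_separation L
  set v := (volume : Measure (EuclideanSpace ℝ (Fin d))).real (Metric.ball 0 1) with hv
  have hv0 : 0 < v := ENNReal.toReal_pos (Metric.measure_ball_pos _ _ one_pos).ne'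
    measure_ball_lt_top.ne
  -- Large enough to contradict `(R / 2) ^ d * v ≤ (1 + 1 / δ) ^ (d - 1) * R ^ (d - 1) * C`; `1 ≤ R`
  -- gives `(R + δ) / δ ≤ (1 + 1 / δ) * R`.
  set R := max 1 (C * (1 + 1 / δ) ^ (d - 1) * 2 ^ d / v + 1) with hRdef
  have hR1 : 1 ≤ R := le_max_left _ _
  have hR2 : C * (1 + 1 / δ) ^ (d - 1) * 2 ^ d / v < R :=
    (lt_add_one _).trans_le (le_max_right _ _)
  refine ⟨R, fun W hW hWC hWd => ?_⟩
  set s := ((W : Set (EuclideanSpace ℝ (Fin n))) ∩ Metric.closedBall 0 R) ∩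
    (L : Set (EuclideanSpace ℝ (Fin n))) with hs
  have hfin : s.Finite :=
    finite_inter_lattice (Metric.isBounded_closedBall.subset Set.inter_subset_right)
  have hle : Submodule.span ℝ s ≤ W := Submodule.span_le.mpr fun x hx => hx.1.1
  by_contra hne
  have hlt := Submodule.finrank_lt_finrank_of_lt (lt_of_le_of_ne hle hne)
  rw [hWd] at hlt
  have hpack := ncard_mul_pow_le hδ (zero_le_one.trans hR1) hsep (s := s) (fun x hx => hx.2)
    (fun x hx => by simpa using hx.1.2) hfin
  set k := finrank ℝ (Submodule.span ℝ s)
  have hcard : (s.ncard : ℝ) ≤ (1 + 1 / δ) ^ (d - 1) * R ^ (d - 1) := by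
    have h1 : (s.ncard : ℝ) ≤ ((R + δ) / δ) ^ k := by
      rw [div_pow, le_div_iff₀ (by positivity)]
      exact hpack
    have h2 : (1 : ℝ) ≤ (R + δ) / δ := by
      rw [le_div_iff₀ hδ]
      linarith
    have h3 : (R + δ) / δ ≤ (1 + 1 / δ) * R := by
      have : (R + δ) / δ = 1 + 1 / δ * R := by field_simp; ring
      rw [this]
      linarith
    calc (s.ncard : ℝ) ≤ ((R + δ) / δ) ^ k := h1
      _ ≤ ((R + δ) / δ) ^ (d - 1) := pow_le_pow_right₀ h2 (by omega)
      _ ≤ ((1 + 1 / δ) * R) ^ (d - 1) := pow_le_pow_left₀ (by positivity) h3 _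
      _ = _ := mul_pow _ _ _
  have hvol := hW.volume_le_ncard_mul R
  rw [hWd, Measure.addHaar_real_closedBall _ _ (by positivity), ← hv,
    finrank_euclideanSpace_fin, div_pow] at hvol
  have hC : 0 ≤ C := hW.latticeDet_pos.le.trans hWC
  have h4 : R ^ d / 2 ^ d * v ≤ (1 + 1 / δ) ^ (d - 1) * R ^ (d - 1) * C :=
    hvol.trans (mul_le_mul hcard hWC hW.latticeDet_pos.le (by positivity))
  have h5 : R ^ d = R ^ (d - 1) * R := by rw [← pow_succ]; congr 1; omega
  rw [div_lt_iff₀ hv0] at hR2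
  have hRpos : 0 < R ^ (d - 1) := by positivity
  rw [h5, div_mul_eq_mul_div, div_le_iff₀ (by positivity)] at h4
  have h6 := mul_lt_mul_of_pos_left hR2 hRpos
  linarith

theorem finite_latticeSubspace_latticeDet_le (L : Submodule ℤ (EuclideanSpace ℝ (Fin n)))
    [DiscreteTopology L] (C : ℝ) : {W | IsLatticeSubspace L W ∧ latticeDet L W ≤ C}.Finite := by
  choose R hR using exists_radius_span_eq L C
  refine ((Set.finite_Iic n).biUnion fun d _ =>
    ((finite_inter_lattice (L := L) (Metric.isBounded_closedBall (x := 0) (r := R d))).powerset.image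
      (Submodule.span ℝ))).subset ?_
  rintro W ⟨hW, hWC⟩
  refine Set.mem_biUnion (x := finrank ℝ W) ?_ ⟨_, ?_, hR _ W hW hWC rfl⟩
  · simpa using Submodule.finrank_le W
  · exact fun x hx => ⟨hx.1.2, hx.2⟩

/-- The supremum defining `M (K, L)` is attained. -/
theorem isGreatest_bodyQuotients (L : Submodule ℤ (EuclideanSpace ℝ (Fin n)))
    [DiscreteTopology L] {K : Set (EuclideanSpace ℝ (Fin n))} (hK : IsClosed K)
    (hKb : Bornology.IsBounded K) (h0 : 0 ∈ K) :
    IsGreatest (bodyQuotients K L) (bodyM K L) := by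
  suffices h : ∃ m, IsGreatest (bodyQuotients K L) m by
    obtain ⟨m, hm⟩ := h
    rwa [bodyM, hm.csSup_eq]
  obtain ⟨T, hT⟩ := hKb.subset_closedBall 0
  set B : ℕ → ℝ := fun d =>
    (volume : Measure (EuclideanSpace ℝ (Fin d))).real (Metric.closedBall 0 T) with hB
  set C : ℝ := ∑ d ∈ Finset.range (n + 1), B d with hC
  have hvol : ∀ W : Submodule ℝ (EuclideanSpace ℝ (Fin n)),
      (volume : Measure W).real {w : W | (w : EuclideanSpace ℝ (Fin n)) ∈ K} ≤ C := fun W => by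
    calc _ ≤ (volume : Measure W).real
          {w : W | (w : EuclideanSpace ℝ (Fin n)) ∈ Metric.closedBall 0 T} :=
          measureReal_mono (fun w hw => hT hw)
            (isBounded_preimage_subtype Metric.isBounded_closedBall).measure_lt_top.ne
      _ = B (finrank ℝ W) := volume_real_subspace_closedBall W T
      _ ≤ C := Finset.single_le_sum (f := B) (fun _ _ => measureReal_nonneg)
          (Finset.mem_range_succ_iff.mpr (by simpa using Submodule.finrank_le W))
  have hfin : {q | q ∈ bodyQuotients K L ∧ 1 ≤ q}.Finite := by
    refine ((finite_latticeSubspace_latticeDet_le L C).image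
      fun W : Submodule ℝ (EuclideanSpace ℝ (Fin n)) =>
      (volume : Measure W).real {w : W | (w : EuclideanSpace ℝ (Fin n)) ∈ K} /
        latticeDet L W).subset ?_
    rintro q ⟨⟨W, hW, rfl⟩, hq⟩
    rw [le_div_iff₀ hW.latticeDet_pos, one_mul] at hq
    exact ⟨W, ⟨hW, hq.trans (hvol W)⟩, rfl⟩
  have hne : {q | q ∈ bodyQuotients K L ∧ 1 ≤ q}.Nonempty := by
    -- The zero subspace supplies a quotient at least `1`, so quotients below `1` cannot affect the
    -- maximum.
    refine ⟨_, ⟨⊥, isLatticeSubspace_bot, rfl⟩, ?_⟩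
    have := isLatticeSubspace_bot.ncard_le (L := L) (s := {0}) (t := K) (Set.finite_singleton 0)
      (by simp) (by simp) hK hKb fun x hx => ⟨0, L.zero_mem, Submodule.zero_mem _, by
        rw [Submodule.mem_bot] at hx
        simpa [hx] using h0⟩
    simpa using this
  obtain ⟨m, hm, hmax⟩ := Set.exists_max_image _ id hfin hne
  refine ⟨m, hm.1, fun q hq => ?_⟩
  rcases le_total 1 q with h | h
  · exact hmax q ⟨hq, h⟩
  · exact h.trans hm.2

end Maximum

/-! ### Counting by covering, and the theorem -/

section Count

variable {n : ℕ} {L : Submodule ℤ (EuclideanSpace ℝ (Fin n))} [DiscreteTopology L]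

/-- Counting lattice points in `K` through a covering of the span of `K ∩ L` by lattice
translates. The vectors `v` are independent lattice vectors in `K`. -/
theorem ncard_le_bodyM {K t : Set (EuclideanSpace ℝ (Fin n))} (hK : Bornology.IsBounded K)
    (ht : IsClosed t) (htb : Bornology.IsBounded t) (h0 : 0 ∈ t)
    (hcov : ∀ d ≤ n, ∀ v : Fin d → EuclideanSpace ℝ (Fin n), (∀ i, v i ∈ K) → ∀ a : Fin d → ℝ,
      ∃ k : Fin d → ℤ, ∀ y ∈ K, ∑ i, (a i - k i) • v i + y ∈ t) :
    ((K ∩ (L : Set (EuclideanSpace ℝ (Fin n)))).ncard : ℝ) ≤ bodyM t L := by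
  set s := K ∩ (L : Set (EuclideanSpace ℝ (Fin n))) with hs
  have hW : IsLatticeSubspace L (Submodule.span ℝ s) := isLatticeSubspace_span fun x hx => hx.2
  refine (hW.ncard_le (finite_inter_lattice hK) (fun x hx => hx.2) Submodule.subset_span ht htb
    fun x hx => ?_).trans ((isGreatest_bodyQuotients L ht htb h0).2 ⟨_, hW, rfl⟩)
  obtain ⟨f, hf, hspan, -⟩ := Submodule.exists_fun_fin_finrank_span_eq ℝ s
  rw [← hspan] at hx
  obtain ⟨a, rfl⟩ := (Submodule.mem_span_range_iff_exists_fun ℝ).mp hx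
  obtain ⟨k, hk⟩ := hcov _ (by simpa using Submodule.finrank_le (Submodule.span ℝ s)) f
    (fun i => (hf i).1) a
  refine ⟨∑ i, k i • f i, L.sum_mem fun i _ => L.smul_mem _ (hf i).2,
    Submodule.sum_mem _ fun i _ => zsmul_mem (Submodule.subset_span (hf i)) _, fun y hy => ?_⟩
  have := hk y hy.1
  simpa only [sub_smul, Finset.sum_sub_distrib, Int.cast_smul_eq_zsmul] using this

end Count

/-- The first conjunct of each part says that the supremum `M` is a maximum. -/
theorem mainTheorem10 (n : ℕ) (L : Submodule ℤ (EuclideanSpace ℝ (Fin n)))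
    [DiscreteTopology L] [IsZLattice ℝ L] :
    (∀ K : Set (EuclideanSpace ℝ (Fin n)), IsSymmConvexBody K →
      IsGreatest (bodyQuotients ((3 * (n : ℝ)) • K) L) (bodyM ((3 * (n : ℝ)) • K) L) ∧
      (K ∩ (L : Set (EuclideanSpace ℝ (Fin n)))).Finite ∧
      ((K ∩ (L : Set (EuclideanSpace ℝ (Fin n)))).ncard : ℝ) ≤ bodyM ((3 * (n : ℝ)) • K) L) ∧
    (∀ r : ℝ, 0 < r →
      IsGreatest (ballQuotients (6 * √(n : ℝ) * r) L) (ballM (6 * √(n : ℝ) * r) L) ∧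
      (Metric.closedBall (0 : EuclideanSpace ℝ (Fin n)) r ∩
        (L : Set (EuclideanSpace ℝ (Fin n)))).Finite ∧
      ((Metric.closedBall (0 : EuclideanSpace ℝ (Fin n)) r ∩
        (L : Set (EuclideanSpace ℝ (Fin n)))).ncard : ℝ) ≤ ballM (6 * √(n : ℝ) * r) L) := by
  refine ⟨fun K hK => ?_, fun r hr => ?_⟩
  · have h0 : (0 : EuclideanSpace ℝ (Fin n)) ∈ K := by
      obtain ⟨x, hx⟩ := hK.interior_nonempty.mono interior_subset
      have hx' : -x ∈ K := by rw [hK.symm]; simpa using hx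
      simpa using hK.convex hx hx' (by norm_num : (0 : ℝ) ≤ 1 / 2) (by norm_num : (0 : ℝ) ≤ 1 / 2)
        (by norm_num)
    have hcomp := hK.isCompact.smul (3 * (n : ℝ))
    have h0' : (0 : EuclideanSpace ℝ (Fin n)) ∈ (3 * (n : ℝ)) • K := ⟨0, h0, by simp⟩
    refine ⟨isGreatest_bodyQuotients L hcomp.isClosed hcomp.isBounded h0',
      finite_inter_lattice hK.isCompact.isBounded,
      ncard_le_bodyM hK.isCompact.isBounded hcomp.isClosed hcomp.isBounded h0' ?_⟩
    intro d hd v hv a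
    refine ⟨fun i => ⌊a i⌋, fun y hy => ?_⟩
    -- For `n = 0` the factor `3 * n` vanishes and `d + 1 ≤ 3 * n` fails, but the space is a point.
    rcases Nat.eq_zero_or_pos n with rfl | hn
    · rwa [Subsingleton.elim (_ + y) 0]
    have hsum := hK.convex.sum_mem_card_smul h0 Finset.univ (fun i => (a i - ⌊a i⌋) • v i)
      fun i _ => hK.convex.smul_mem_of_zero_mem h0 (hv i)
        ⟨Int.fract_nonneg (a i), (Int.fract_lt_one (a i)).le⟩
    rw [Finset.card_univ, Fintype.card_fin] at hsum
    have hdn : (d : ℝ) ≤ n := by exact_mod_cast hd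
    have hn1 : (1 : ℝ) ≤ n := by exact_mod_cast hn
    -- `d • K` holds the rounding error and `1 • K` the point `y`; the rest is slack, filled by `0`.
    have hdecomp : (3 * (n : ℝ)) • K = ((d : ℝ) • K + (1 : ℝ) • K) + (3 * (n : ℝ) - d - 1) • K := by
      rw [← hK.convex.add_smul (by positivity) zero_le_one,
        ← hK.convex.add_smul (by positivity) (by linarith)]
      congr 1
      ring
    rw [hdecomp, ← add_zero (_ + y)]
    exact Set.add_mem_add (Set.add_mem_add hsum ⟨y, hy, one_smul ℝ y⟩) ⟨0, h0, smul_zero _⟩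
  · rw [ballM, ballQuotients_eq]
    have h0 : (0 : EuclideanSpace ℝ (Fin n)) ∈ Metric.closedBall 0 (6 * √(n : ℝ) * r) :=
      Metric.mem_closedBall_self (by positivity)
    refine ⟨isGreatest_bodyQuotients L Metric.isClosed_closedBall Metric.isBounded_closedBall h0,
      finite_inter_lattice Metric.isBounded_closedBall,
      ncard_le_bodyM Metric.isBounded_closedBall Metric.isClosed_closedBall
        Metric.isBounded_closedBall h0 ?_⟩
    intro d hd v hv a
    obtain ⟨k, hk⟩ := exists_int_norm_sq_sum_le Finset.univ v (r := r)
      (fun i _ => by simpa using hv i) a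
    refine ⟨k, fun y hy => ?_⟩
    rcases Nat.eq_zero_or_pos n with rfl | hn
    · rwa [Subsingleton.elim (_ + y) 0]
    have hdn : (d : ℝ) ≤ n := by exact_mod_cast hd
    have hn1 : 1 ≤ √(n : ℝ) := Real.one_le_sqrt.mpr (by exact_mod_cast hn)
    rw [Finset.card_univ, Fintype.card_fin] at hk
    have hle : ‖∑ i, (a i - k i) • v i‖ ≤ √(n : ℝ) * r := by
      refine abs_le_of_sq_le_sq' ?_ (by positivity) |>.2
      rw [mul_pow, Real.sq_sqrt (Nat.cast_nonneg n)]
      exact hk.trans (mul_le_mul_of_nonneg_right hdn (sq_nonneg r))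
    rw [mem_closedBall_zero_iff] at hy ⊢
    have := norm_add_le (∑ i, (a i - k i) • v i) y
    -- Since `1 ≤ √n`, the sum `√n * r + r` is at most `2 * √n * r`.
    nlinarith
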